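/- Let $\nu\ge 0$ and let $A,B:\mathbb R^3\times\mathbb R^3\times[0,\infty)\to\mathbb R^3$, $(x,w,t)\mapsto A(x,w,t),B(x,w,t)$, be Lipschitz continuous in $(x,w)$ uniformly in $t$, with $A(0,0,t)$ and $B(0,0,t)$ bounded on bounded time intervals. Let $f(w;x,t)$ ($w,x\in\mathbb R^3$, $t\ge 0$) be a classical solution of $$\Big(\frac{\partial}{\partial t}+B^i\frac{\partial}{\partial x^i}+\frac{\partial B^i}{\partial x^i}-\nu\Delta_x\Big)f=\frac{\partial}{\partial w^i}\big(fA^i\big),\qquad t>0$$ (summation over $i=1,2,3$): $f$ is continuous on $t\ge0$; for $t>0$ it is $C^1$ in $w$, $C^2$ in $x$ and differentiable in $t$, these derivatives being jointly continuous; the derivatives $\partial B^i/\partial x^i$ and $\partial(fA^i)/\partial w^i$ exist; and the equation holds at every point with $t>0$. Suppose also that for every $T$ there are $C,k$ with $|f(w;x,t)|\le Ce^{k(|x|^2+|w|^2)}$ for $0\le t\le T$. (1) If $f(w;x,0)\ge0$ for all $x,w$, then $f(w;x,t)\ge0$ for all $t\ge0$ and all $x,w$. For (2) and (3) suppose that $f$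 decays sufficiently fast as $|w|\to\infty$, in the following sense. For every $T$ there are $k\in\mathbb R$ and an integrable $g$ on $\mathbb R^3$ with $|f(w;x,t)|\le e^{k|x|^2}g(w)$ for $0\le t\le T$; and for all $0<a\le b$ and $R>0$ there is an integrable $g$ on $\mathbb R^3$ such that $|f||A|$, $|f||B|$, $|\partial_tf|$, $(1+|B|)|\nabla_xf|$ and $|\nabla_x^2f|$ are all at most $g(w)$ for $a\le t\le b$, $|x|\le R$ and all $w$. Call a function on $\mathbb R^3$ a PDF if it is non-negative and its integral over $\mathbb R^3$ equals $1$, and suppose that $f(\cdot\,;x,0)$ is a PDF for every $x$. (2) $f(\cdot\,;x,t)$ is a PDF for all $x$ and all $t>0$ if and only if $$\frac{\partial}{\partial x^i}\int_{\mathbb R^3}B^i(x,w,t)f(w;x,t)\,dw=0\qquad\text{for all }x\text{ and all }t>0$$ (the partial derivatives being part of the claim to exist). (3) If $B$ does not depend on $w$ and $\partial B^i/\partial x^i=0$ (for $t>0$), then $f(\cdot\,;x,t)$ is a PDF for all $x$ and all $t>0$. -/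

import Mathlib

open MeasureTheory Laplacian
open scoped NNReal

/-- Three-dimensional Euclidean space. -/
abbrev E3 : Type := EuclideanSpace ℝ (Fin 3)

/-- The `i`-th unit coordinate vector. -/
noncomputable def unitVec (i : Fin 3) : E3 := EuclideanSpace.single i (1 : ℝ)

/-- A vector field `V(x, w, t)` which is Lipschitz in `(x, w)` uniformly in `t ≥ 0`, and whose value
at the origin stays bounded on bounded time intervals. -/
structure IsLipschitzField (V : E3 → E3 → ℝ → E3) : Prop where
  lipschitz : ∃ L : ℝ≥0, ∀ t : ℝ, 0 ≤ t → LipschitzWith L (fun p : E3 × E3 => V p.1 p.2 t)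
  bounded_at_zero : ∀ T : ℝ, ∃ K : ℝ, ∀ t : ℝ, 0 ≤ t → t ≤ T → ‖V 0 0 t‖ ≤ K

/-- The divergence `∂B^i/∂x^i` of `B(x, w, t)` in the variable `x`. -/
noncomputable def divX (B : E3 → E3 → ℝ → E3) (x w : E3) (t : ℝ) : ℝ :=
  ∑ i, lineDeriv ℝ (fun y : E3 => B y w t i) x (unitVec i)

/-- Classical solutions `f(w; x, t)`, written `f w x t`, of
`(∂_t + B^i ∂_{x^i} + ∂B^i/∂x^i - ν Δ_x) f = ∂_{w^i} (f A^i)` on `t > 0`, continuous up to `t = 0`.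
The function `f` is `C¹` in `(w, t)` and `C²` in `x`, and the derivatives of the coefficients that
occur in the equation exist. -/
structure IsClassicalSolution (ν : ℝ) (A B : E3 → E3 → ℝ → E3) (f : E3 → E3 → ℝ → ℝ) : Prop where
  continuousOn : ContinuousOn (fun p : E3 × E3 × ℝ => f p.1 p.2.1 p.2.2) {p | 0 ≤ p.2.2}
  contDiff_w : ∀ (x : E3) (t : ℝ), 0 < t → ContDiff ℝ 1 (fun v : E3 => f v x t)
  contDiff_x : ∀ (w : E3) (t : ℝ), 0 < t → ContDiff ℝ 2 (fun y : E3 => f w y t)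
  differentiable_t : ∀ (w x : E3) (t : ℝ), 0 < t → DifferentiableAt ℝ (fun s : ℝ => f w x s) t
  continuousOn_w : ContinuousOn
    (fun p : E3 × E3 × ℝ => fderiv ℝ (fun v : E3 => f v p.2.1 p.2.2) p.1) {p | 0 < p.2.2}
  continuousOn_x : ContinuousOn
    (fun p : E3 × E3 × ℝ => fderiv ℝ (fun y : E3 => f p.1 y p.2.2) p.2.1) {p | 0 < p.2.2}
  continuousOn_xx : ContinuousOn
    (fun p : E3 × E3 × ℝ => iteratedFDeriv ℝ 2 (fun y : E3 => f p.1 y p.2.2) p.2.1) {p | 0 < p.2.2}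
  continuousOn_t : ContinuousOn
    (fun p : E3 × E3 × ℝ => deriv (fun s : ℝ => f p.1 p.2.1 s) p.2.2) {p | 0 < p.2.2}
  differentiable_B : ∀ (w x : E3) (t : ℝ), 0 < t → ∀ i,
    LineDifferentiableAt ℝ (fun y : E3 => B y w t i) x (unitVec i)
  differentiable_fA : ∀ (w x : E3) (t : ℝ), 0 < t → ∀ i,
    LineDifferentiableAt ℝ (fun v : E3 => f v x t * A x v t i) w (unitVec i)
  equation : ∀ (w x : E3) (t : ℝ), 0 < t →
    deriv (fun s : ℝ => f w x s) t
      + ∑ i, B x w t i * lineDeriv ℝ (fun y : E3 => f w y t) x (unitVec i)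
      + divX B x w t * f w x t
      - ν * Δ (fun y : E3 => f w y t) x
    = ∑ i, lineDeriv ℝ (fun v : E3 => f v x t * A x v t i) w (unitVec i)

/-- At most Gaussian growth in `(x, w)`, uniformly on bounded time intervals. -/
def HasGaussianGrowth (f : E3 → E3 → ℝ → ℝ) : Prop :=
  ∀ T : ℝ, ∃ C k : ℝ, ∀ (w x : E3) (t : ℝ), 0 ≤ t → t ≤ T →
    |f w x t| ≤ C * Real.exp (k * (‖x‖ ^ 2 + ‖w‖ ^ 2))

/-- Sufficiently fast decay as `|w| → ∞`: the function `f` is dominated by `e^{k|x|²} g(w)` with `g`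
integrable, uniformly on bounded time intervals, and `f A`, `f B` and the derivatives of `f` are
dominated by an integrable function of `w`, locally uniformly in `x` and `t > 0`. -/
structure DecaysFast (A B : E3 → E3 → ℝ → E3) (f : E3 → E3 → ℝ → ℝ) : Prop where
  decay : ∀ T : ℝ, ∃ (k : ℝ) (g : E3 → ℝ), Integrable g ∧
    ∀ (w x : E3) (t : ℝ), 0 ≤ t → t ≤ T → |f w x t| ≤ Real.exp (k * ‖x‖ ^ 2) * g w
  decay_deriv : ∀ a b R : ℝ, 0 < a → ∃ g : E3 → ℝ, Integrable g ∧
    ∀ (w x : E3) (t : ℝ), a ≤ t → t ≤ b → ‖x‖ ≤ R →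
      |f w x t| * ‖A x w t‖ ≤ g w ∧
      |f w x t| * ‖B x w t‖ ≤ g w ∧
      |deriv (fun s : ℝ => f w x s) t| ≤ g w ∧
      (1 + ‖B x w t‖) * ‖fderiv ℝ (fun y : E3 => f w y t) x‖ ≤ g w ∧
      ‖iteratedFDeriv ℝ 2 (fun y : E3 => f w y t) x‖ ≤ g w

/-- Probability density functions with respect to Lebesgue measure on `ℝ³`. -/
def IsPDF (p : E3 → ℝ) : Prop :=
  (∀ w, 0 ≤ p w) ∧ Integrable p ∧ ∫ w, p w = 1

/-- The condition `∂/∂x^i ∫ B^i(x, w, t) f(w; x, t) dw = 0` for all `x` and `t > 0`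
(including the existence of the partial derivatives). -/
def FluxDivergenceFree (B : E3 → E3 → ℝ → E3) (f : E3 → E3 → ℝ → ℝ) : Prop :=
  ∀ (x : E3) (t : ℝ), 0 < t →
    (∀ i, LineDifferentiableAt ℝ (fun y : E3 => ∫ w, B y w t i * f w y t) x (unitVec i)) ∧
    ∑ i, lineDeriv ℝ (fun y : E3 => ∫ w, B y w t i * f w y t) x (unitVec i) = 0

/-! Non-negativity is a minimum principle. The product rule for `f A` holds up to an error `L |f|`
because `A` is Lipschitz, and `|∂B^i/∂x^i|` is bounded. So wherever `f < 0`, `f` is a supersolution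
of a linear drift-diffusion equation whose zeroth-order coefficient is a constant `l`, and the
factor `e^{-lt}` removes that term. A multiple `ε` of the barrier `exp (K(t) (1 + |x|² + |w|²))`
beats the Gaussian growth of `f`, so if `f` were negative somewhere, the sum would attain a negative
minimum. The derivative conditions there are contradictory once `K` grows fast enough compared with
the drifts, which grow linearly, and with `ν`. This works on time slabs of fixed length, which are
then chained (`nonneg_of_supersolution`).

For the mass `F(x,t) = ∫ f dw`, integrate the equation over `w`. The right side is a divergence in
`w` and disappears (`integral_sum_lineDeriv_eq_zero`), leaving `∂_t F + ∂_{x^i} ∫ B^i f dw - ν Δ F =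
0` (`integrated_equation`). If `F = 1`, the flux divergence vanishes. Conversely, a vanishing flux
divergence leaves the heat equation for `F`, and a divergence-free `B` independent of `w` leaves
`∂_t F + B · ∇F = ν Δ F`. In both cases the minimum principle, applied to `F - 1` and `1 - F` with
`w` as a dummy variable, gives `F = 1` (`integral_eq_one`). -/

/-! ### Calculus at a minimum and along coordinate lines -/

/-- Only earlier times are compared, because the minimum may sit at the final time of a slab. -/
theorem deriv_nonpos_of_le_on_left {G : ℝ → ℝ} {G' a t : ℝ} (hG : HasDerivAt G G' t) (hat : a < t)
    (hmin : ∀ s, a ≤ s → s ≤ t → G t ≤ G s) : G' ≤ 0 := by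
  have h := hG.hasDerivWithinAt (s := Set.Iio t)
  rw [hasDerivWithinAt_iff_tendsto_slope' (by simp)] at h
  refine le_of_tendsto h ?_
  filter_upwards [Ioo_mem_nhdsLT hat] with s hs
  rw [slope_def_field]
  exact div_nonpos_of_nonneg_of_nonpos (sub_nonneg.2 (hmin s hs.1.le hs.2.le))
    (sub_nonpos.2 hs.2.le)

/-- If `G2 < 0`, the second derivative test makes `a` a local maximum as well, so `G` is locally
constant and `G2 = 0`. Continuity of the second derivative is not needed. -/
theorem second_deriv_nonneg_of_isLocalMin {G G1 : ℝ → ℝ} {a G2 : ℝ}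
    (hG : ∀ s, HasDerivAt G (G1 s) s) (hG1 : HasDerivAt G1 G2 a) (hmin : IsLocalMin G a) :
    0 ≤ G2 := by
  by_contra! hneg
  have hd : deriv G = G1 := funext fun s => (hG s).deriv
  have h2 : deriv (deriv G) a = G2 := by rw [hd]; exact hG1.deriv
  have hmax := isLocalMax_of_deriv_deriv_neg (by rw [h2]; exact hneg) hmin.deriv_eq_zero
    (hG a).continuousAt
  have hconst : G =ᶠ[nhds a] fun _ => G a := by
    filter_upwards [hmin, hmax] with s h h' using le_antisymm h' h
  have : deriv (deriv G) a = 0 := by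
    have := hconst.deriv.deriv_eq
    simpa using this
  linarith

theorem norm_sq_add_smul_unitVec (x : E3) (s : ℝ) (i : Fin 3) :
    ‖x + s • unitVec i‖ ^ 2 = ‖x‖ ^ 2 + 2 * s * x i + s ^ 2 := by
  rw [norm_add_sq_real, norm_smul, inner_smul_right]
  simp [unitVec, EuclideanSpace.inner_single_right]
  ring

/-- With `q = 1 + |x|² + |w|²` and `y` a coordinate of `x` or `w`, this is the barrier restricted to
a coordinate line. -/
theorem hasDerivAt_exp_quadratic (c q y s : ℝ) :
    HasDerivAt (fun s : ℝ => Real.exp (c * (q + 2 * s * y + s ^ 2)))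
      (2 * c * (y + s) * Real.exp (c * (q + 2 * s * y + s ^ 2))) s := by
  have h : HasDerivAt (fun s : ℝ => c * (q + 2 * s * y + s ^ 2)) (2 * c * (y + s)) s := by
    have := ((((hasDerivAt_id s).const_mul 2).mul_const y).const_add q).add
      ((hasDerivAt_id s).pow 2)
    refine (this.const_mul c).congr_deriv ?_
    simp; ring
  exact h.exp.congr_deriv (by ring)

theorem hasDerivAt_deriv_exp_quadratic (c q y : ℝ) :
    HasDerivAt (fun s : ℝ => 2 * c * (y + s) * Real.exp (c * (q + 2 * s * y + s ^ 2)))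
      ((4 * c ^ 2 * y ^ 2 + 2 * c) * Real.exp (c * q)) 0 := by
  have := (((hasDerivAt_id (0:ℝ)).const_add y).const_mul (2 * c)).mul
    (hasDerivAt_exp_quadratic c q y 0)
  refine this.congr_deriv ?_
  simp; ring

/-- Derivatives along a coordinate line at all times, from the derivatives at time zero. -/
theorem hasDerivAt_along_unitVec {h h' : E3 → ℝ} {i : Fin 3}
    (H : ∀ x, HasDerivAt (fun s : ℝ => h (x + s • unitVec i)) (h' x) 0) (x : E3) (s : ℝ) :
    HasDerivAt (fun s : ℝ => h (x + s • unitVec i)) (h' (x + s • unitVec i)) s := by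
  have h1 := H (x + s • unitVec i)
  rw [← sub_self s] at h1
  refine (HasDerivAt.comp_sub_const s s h1).congr_of_eventuallyEq
    (Filter.Eventually.of_forall fun r => ?_)
  simp only
  congr 1
  rw [add_assoc, ← add_smul]; congr 2; ring

/-! ### The minimum principle -/

section MaximumPrinciple

variable {ν : ℝ} {a b : E3 → E3 → ℝ → E3} {l : ℝ} {f ft : E3 → E3 → ℝ → ℝ}
  {fx fxx fw : Fin 3 → E3 → E3 → ℝ → ℝ}

set_option maxHeartbeats 1000000 in
/-- The minimum principle on a short time slab: the barrier `exp (K(t) (1 + |x|² + |w|²))` with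
`K(t) = k + 1 + M (t - t₀)` dominates the Gaussian growth of `f`. -/
theorem nonneg_of_supersolution_slab (hν : 0 ≤ ν) (hl : 0 ≤ l)
    (hcont : ContinuousOn (fun p : E3 × E3 × ℝ => f p.1 p.2.1 p.2.2) {p | 0 ≤ p.2.2})
    (hft : ∀ w x t, 0 < t → HasDerivAt (fun s => f w x s) (ft w x t) t)
    (hfx : ∀ i w x t, 0 < t →
      HasDerivAt (fun s : ℝ => f w (x + s • unitVec i) t) (fx i w x t) 0)
    (hfxx : ∀ i w x t, 0 < t →
      HasDerivAt (fun s : ℝ => fx i w (x + s • unitVec i) t) (fxx i w x t) 0)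
    (hfw : ∀ i w x t, 0 < t →
      HasDerivAt (fun s : ℝ => f (w + s • unitVec i) x t) (fw i w x t) 0)
    (hsuper : ∀ w x t, 0 < t → f w x t < 0 →
      0 ≤ ft w x t + ∑ i, b x w t i * fx i w x t - ν * ∑ i, fxx i w x t
        - ∑ i, a x w t i * fw i w x t - l * f w x t)
    {t₀ t₁ C k β M : ℝ} (ht₀ : 0 ≤ t₀) (hC : 0 ≤ C) (hk : 0 ≤ k) (hβ : 0 ≤ β)
    (hgrowth : ∀ w x t, t₀ ≤ t → t ≤ t₁ →
      |f w x t| ≤ C * Real.exp (k * (‖x‖ ^ 2 + ‖w‖ ^ 2)))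
    (ha : ∀ w x t, t₀ ≤ t → t ≤ t₁ →
      |∑ i, a x w t i * w i| ≤ β * (1 + ‖x‖ ^ 2 + ‖w‖ ^ 2))
    (hb : ∀ w x t, t₀ ≤ t → t ≤ t₁ →
      |∑ i, b x w t i * x i| ≤ β * (1 + ‖x‖ ^ 2 + ‖w‖ ^ 2))
    (hM : M = 4 * (k + 2) * β + ν * (4 * (k + 2) ^ 2 + 6 * (k + 2)) + 1)
    (hslab : M * (t₁ - t₀) ≤ 1) (h0 : ∀ w x, 0 ≤ f w x t₀) :
    ∀ w x t, t₀ ≤ t → t ≤ t₁ → 0 ≤ f w x t := by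
  intro w₁ x₁ s₁ hs₀ hs₁
  by_contra! hneg
  have hMpos : 0 < M := by rw [hM]; positivity
  set K : ℝ → ℝ := fun t => k + 1 + M * (t - t₀) with hK
  set φ : E3 → E3 → ℝ → ℝ := fun w x t => Real.exp (K t * (1 + ‖x‖ ^ 2 + ‖w‖ ^ 2)) with hφ
  have hφpos : ∀ w x t, 0 < φ w x t := fun _ _ _ => Real.exp_pos _
  set u : E3 → E3 → ℝ → ℝ := fun w x t => Real.exp (-l * t) * f w x t with hu
  have hu₁ : u w₁ x₁ s₁ < 0 := mul_neg_of_pos_of_neg (Real.exp_pos _) hneg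
  obtain ⟨ε, hε, hε₁⟩ : ∃ ε > 0, u w₁ x₁ s₁ + ε * φ w₁ x₁ s₁ < 0 := by
    -- This `ε` makes the perturbed value exactly half of the negative value `u w₁ x₁ s₁`.
    refine ⟨-u w₁ x₁ s₁ / (2 * φ w₁ x₁ s₁), div_pos (by linarith) (by linarith [hφpos w₁ x₁ s₁]), ?_⟩
    have := (hφpos w₁ x₁ s₁).ne'
    field_simp
    linarith
  set g : E3 → E3 → ℝ → ℝ := fun w x t => u w x t + ε * φ w x t with hg
  -- `C / ε` makes the barrier win outside radius `R`, the norms keep the bad point inside, and the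
  -- `1` gives `R ≤ R ^ 2`.
  set R : ℝ := 1 + C / ε + ‖w₁‖ + ‖x₁‖ with hR
  have hCε : 0 ≤ C / ε := by positivity
  have hR1 : 1 ≤ R := by linarith [norm_nonneg w₁, norm_nonneg x₁]
  have hKk : ∀ t, t₀ ≤ t → k + 1 ≤ K t := fun t ht => by
    have := mul_nonneg hMpos.le (sub_nonneg.2 ht)
    simp only [hK]; linarith
  have hout : ∀ w x t, t₀ ≤ t → t ≤ t₁ → R ^ 2 ≤ ‖x‖ ^ 2 + ‖w‖ ^ 2 → 0 ≤ g w x t := by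
    intro w x t h1 h2 h3
    set r := ‖x‖ ^ 2 + ‖w‖ ^ 2 with hr
    have hfu : -(C * Real.exp (k * r)) ≤ u w x t := by
      have e1 : Real.exp (-l * t) ≤ 1 := Real.exp_le_one_iff.2 (by nlinarith)
      have e0 := (Real.exp_pos (-l * t)).le
      have := hgrowth w x t h1 h2
      have h5 : |u w x t| ≤ |f w x t| := by
        rw [hu]; simp only; rw [abs_mul, abs_of_nonneg e0]
        exact mul_le_of_le_one_left (abs_nonneg _) e1
      linarith [neg_abs_le (u w x t)]
    -- The spare unit in `k + 1 ≤ K t` supplies a factor `e^r ≥ 1 + r` beyond the growth of `f`.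
    have hφb : (1 + r) * Real.exp (k * r) ≤ φ w x t := by
      have : Real.exp r * Real.exp (k * r) ≤ φ w x t := by
        rw [hφ, ← Real.exp_add]
        refine Real.exp_le_exp.2 ?_
        have hr0 : 0 ≤ r := by positivity
        have : (k + 1) * (1 + r) ≤ K t * (1 + r) := by
          exact mul_le_mul_of_nonneg_right (hKk t h1) (by linarith)
        rw [add_assoc 1]
        linarith
      refine le_trans ?_ this
      gcongr
      linarith [Real.add_one_le_exp r]
    have hC' : C ≤ ε * (1 + r) := by
      have : C / ε ≤ 1 + r := by nlinarith [norm_nonneg w₁, norm_nonneg x₁]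
      rwa [div_le_iff₀ hε, mul_comm] at this
    have : C * Real.exp (k * r) ≤ ε * φ w x t := by
      calc C * Real.exp (k * r) ≤ ε * (1 + r) * Real.exp (k * r) := by gcongr
        _ = ε * ((1 + r) * Real.exp (k * r)) := by ring
        _ ≤ _ := by gcongr
    simp only [hg]; linarith
  have hgcont : ContinuousOn (fun p : E3 × E3 × ℝ => g p.1 p.2.1 p.2.2) {p | 0 ≤ p.2.2} := by
    simp only [hg, hu, hφ, hK]
    refine ContinuousOn.add (ContinuousOn.mul (by fun_prop) hcont) (by fun_prop)
  let S : Set (E3 × E3 × ℝ) :=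
    Metric.closedBall 0 R ×ˢ (Metric.closedBall 0 R ×ˢ Set.Icc t₀ t₁)
  have hS : IsCompact S := (isCompact_closedBall 0 R).prod
    ((isCompact_closedBall 0 R).prod isCompact_Icc)
  have hmem : (w₁, x₁, s₁) ∈ S := by
    refine ⟨?_, ?_, hs₀, hs₁⟩ <;> rw [mem_closedBall_zero_iff] <;>
      linarith [norm_nonneg w₁, norm_nonneg x₁]
  obtain ⟨⟨w, x, t⟩, ⟨hw, hx, ht⟩, hmin⟩ := hS.exists_isMinOn ⟨_, hmem⟩
    (hgcont.mono fun p hp => ht₀.trans hp.2.2.1)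
  simp only at hw hx ht
  -- The minimum over the compact set is negative and `g ≥ 0` outside the large ball, so it is a
  -- minimum over the whole slab. The derivative tests therefore need no care at the boundary of the
  -- balls.
  have hglob : ∀ w' x' t', t₀ ≤ t' → t' ≤ t₁ → g w x t ≤ g w' x' t' := by
    intro w' x' t' h1 h2
    have hm1 : g w x t ≤ g w₁ x₁ s₁ := hmin hmem
    by_cases hin : (w', x', t') ∈ S
    · exact hmin hin
    · refine (hm1.trans hε₁.le).trans (hout w' x' t' h1 h2 ?_)
      by_contra! hlt
      refine hin ⟨?_, ?_, h1, h2⟩ <;> rw [mem_closedBall_zero_iff] <;>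
        refine abs_le_of_sq_le_sq' ?_ (by linarith) |>.2 <;> nlinarith [sq_nonneg ‖x'‖, sq_nonneg ‖w'‖]
  have hgneg : g w x t < 0 := (hglob w₁ x₁ s₁ hs₀ hs₁).trans_lt hε₁
  have huneg : u w x t < 0 := by
    have := mul_pos hε (hφpos w x t)
    simp only [hg] at hgneg; linarith
  have hfneg : f w x t < 0 := by
    by_contra! h
    exact absurd huneg (not_lt.2 (mul_nonneg (Real.exp_pos _).le h))
  -- The initial data exclude `t = t₀`, so there is room to the left of `t` for the time derivative
  -- test.
  have htt : t₀ < t := lt_of_le_of_ne ht.1 fun h => absurd hfneg (not_lt.2 (h ▸ h0 w x))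
  have htpos : 0 < t := ht₀.trans_lt htt
  set q : ℝ := 1 + ‖x‖ ^ 2 + ‖w‖ ^ 2 with hq
  have hq1 : 1 ≤ q := by simp only [hq]; nlinarith [sq_nonneg ‖x‖, sq_nonneg ‖w‖]
  set E := Real.exp (-l * t) with hE
  have hEpos : 0 < E := Real.exp_pos _
  set P := φ w x t with hP
  have hPpos : 0 < P := hφpos w x t
  have hP' : P = Real.exp (K t * q) := rfl
  -- first-order condition in time
  have d_t : E * ft w x t - l * E * f w x t + ε * (M * q * P) ≤ 0 := by
    have e1 : HasDerivAt (fun s => Real.exp (-l * s)) (-l * E) t := by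
      have := ((hasDerivAt_id t).const_mul (-l)).exp
      exact this.congr_deriv (by simp [hE]; ring)
    have e2 : HasDerivAt (fun s => φ w x s) (M * q * P) t := by
      have : HasDerivAt (fun s => K s * q) (M * q) t := by
        have := ((((hasDerivAt_id t).sub_const t₀).const_mul M).const_add (k + 1)).mul_const q
        exact this.congr_deriv (by simp)
      exact this.exp.congr_deriv (by rw [hP']; ring)
    have e3 : HasDerivAt (fun s => g w x s)
        (-l * E * f w x t + E * ft w x t + ε * (M * q * P)) t :=
      (e1.mul (hft w x t htpos)).add (e2.const_mul ε)
    have := deriv_nonpos_of_le_on_left e3 htt fun s h1 h2 => hglob w x s h1 (h2.trans ht.2)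
    linarith
  -- first-order condition in `w`
  have d_w : ∀ i, E * fw i w x t = -(ε * (2 * K t * w i * P)) := by
    intro i
    have e2 : HasDerivAt (fun s : ℝ => φ (w + s • unitVec i) x t) (2 * K t * w i * P) 0 := by
      have := hasDerivAt_exp_quadratic (K t) q (w i) 0
      refine (this.congr_of_eventuallyEq (Filter.Eventually.of_forall fun s => ?_)).congr_deriv
        (by simp [hP'])
      simp only [hφ, norm_sq_add_smul_unitVec, hq]
      ring_nf
    have e3 : HasDerivAt (fun s : ℝ => g (w + s • unitVec i) x t)
        (E * fw i w x t + ε * (2 * K t * w i * P)) 0 :=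
      ((hfw i w x t htpos).const_mul E).add (e2.const_mul ε)
    have hm : IsLocalMin (fun s : ℝ => g (w + s • unitVec i) x t) 0 :=
      Filter.Eventually.of_forall fun s => by simpa using hglob _ _ _ ht.1 ht.2
    have := hm.hasDerivAt_eq_zero e3
    linarith
  -- first- and second-order conditions in `x`
  have d_x : ∀ i, E * fx i w x t = -(ε * (2 * K t * x i * P)) ∧
      -(ε * ((4 * K t ^ 2 * x i ^ 2 + 2 * K t) * P)) ≤ E * fxx i w x t := by
    intro i
    have hfe : (fun s : ℝ => φ w (x + s • unitVec i) t) =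
        fun s => Real.exp (K t * (q + 2 * s * x i + s ^ 2)) := by
      funext s
      simp only [hφ, norm_sq_add_smul_unitVec, hq]
      ring_nf
    have e2 : ∀ s, HasDerivAt (fun s : ℝ => φ w (x + s • unitVec i) t)
        (2 * K t * (x i + s) * Real.exp (K t * (q + 2 * s * x i + s ^ 2))) s := by
      rw [hfe]; exact hasDerivAt_exp_quadratic (K t) q (x i)
    have e3 : ∀ s, HasDerivAt (fun s : ℝ => g w (x + s • unitVec i) t)
        (E * fx i w (x + s • unitVec i) t +
          ε * (2 * K t * (x i + s) * Real.exp (K t * (q + 2 * s * x i + s ^ 2)))) s := fun s =>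
      ((hasDerivAt_along_unitVec (h := fun y => f w y t) (h' := fun y => fx i w y t)
        (fun y => hfx i w y t htpos) x s).const_mul E).add ((e2 s).const_mul ε)
    have e4 := ((hfxx i w x t htpos).const_mul E).add
      ((hasDerivAt_deriv_exp_quadratic (K t) q (x i)).const_mul ε)
    have hm : IsLocalMin (fun s : ℝ => g w (x + s • unitVec i) t) 0 :=
      Filter.Eventually.of_forall fun s => by simpa using hglob _ _ _ ht.1 ht.2
    have h1 := hm.hasDerivAt_eq_zero (e3 0)
    have h2 := second_deriv_nonneg_of_isLocalMin e3 e4 hm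
    simp only [zero_smul, add_zero, mul_zero, zero_mul, ← hP', ne_eq, OfNat.ofNat_ne_zero,
      not_false_eq_true, zero_pow] at h1 h2
    constructor <;> linarith
  clear_value q E P K
  have hsum := mul_nonneg hEpos.le (hsuper w x t htpos hfneg)
  have s1 : E * ∑ i, b x w t i * fx i w x t = -(ε * (2 * K t * (∑ i, b x w t i * x i) * P)) := by
    simp only [Fin.sum_univ_three]
    linear_combination b x w t 0 * (d_x 0).1 + b x w t 1 * (d_x 1).1 + b x w t 2 * (d_x 2).1
  have s2 : E * ∑ i, a x w t i * fw i w x t = -(ε * (2 * K t * (∑ i, a x w t i * w i) * P)) := by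
    simp only [Fin.sum_univ_three]
    linear_combination a x w t 0 * d_w 0 + a x w t 1 * d_w 1 + a x w t 2 * d_w 2
  have s3 : -(ε * ((4 * K t ^ 2 * ‖x‖ ^ 2 + 6 * K t) * P)) ≤ E * ∑ i, fxx i w x t := by
    rw [EuclideanSpace.real_norm_sq_eq]
    simp only [Fin.sum_univ_three]
    linarith [(d_x 0).2, (d_x 1).2, (d_x 2).2]
  have s3' := mul_le_mul_of_nonneg_left s3 hν
  have hKt : 0 ≤ K t := by linarith [hKk t ht.1]
  -- The length of the slab caps `K` at `k + 2`, the value for which `M` was computed.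
  have hKt2 : K t ≤ k + 2 := by
    have : M * (t - t₀) ≤ M * (t₁ - t₀) := by
      exact mul_le_mul_of_nonneg_left (by linarith [ht.2]) hMpos.le
    simp only [hK]; linarith
  have hbx := abs_le.1 (hb w x t ht.1 ht.2)
  have haw := abs_le.1 (ha w x t ht.1 ht.2)
  rw [← hq] at hbx haw
  have hxq : ‖x‖ ^ 2 ≤ q := by simp only [hq]; nlinarith [sq_nonneg ‖w‖]
  -- At the minimum all derivatives of `f` can be traded for derivatives of the barrier. The terms
  -- in `l` cancel, and `ε P > 0` is divided out.
  have hbr : M * q + 2 * K t * (∑ i, b x w t i * x i) -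
      ν * (4 * K t ^ 2 * ‖x‖ ^ 2 + 6 * K t) - 2 * K t * (∑ i, a x w t i * w i) ≤ 0 := by
    have : (ε * P) * (M * q + 2 * K t * (∑ i, b x w t i * x i) -
      ν * (4 * K t ^ 2 * ‖x‖ ^ 2 + 6 * K t) - 2 * K t * (∑ i, a x w t i * w i)) ≤ 0 := by
      linear_combination s3' + d_t + hsum + s1 - s2
    exact nonpos_of_mul_nonpos_right this (by positivity)
  have t1 : 2 * K t * (∑ i, b x w t i * x i) ≥ -(2 * (k + 2) * β * q) := by
    have h1 : K t * (β * q) ≤ (k + 2) * (β * q) := by gcongr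
    have h2 := mul_le_mul_of_nonneg_left hbx.1 hKt
    linarith
  have t2 : 2 * K t * (∑ i, a x w t i * w i) ≤ 2 * (k + 2) * β * q := by
    have h1 : K t * (β * q) ≤ (k + 2) * (β * q) := by gcongr
    have h2 := mul_le_mul_of_nonneg_left haw.2 hKt
    linarith
  have t3 : ν * (4 * K t ^ 2 * ‖x‖ ^ 2 + 6 * K t) ≤ ν * ((4 * (k + 2) ^ 2 + 6 * (k + 2)) * q) := by
    refine mul_le_mul_of_nonneg_left ?_ hν
    have h1 : 4 * K t ^ 2 * ‖x‖ ^ 2 ≤ 4 * (k + 2) ^ 2 * q := by gcongr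
    have h2 : 6 * K t ≤ 6 * (k + 2) * q := by nlinarith
    linarith
  -- All terms but the `+ 1` in `M` are used up by the drift and diffusion bounds; what remains is
  -- `q ≤ 0`, against `q ≥ 1`.
  have hMq : M * q = (4 * (k + 2) * β + ν * (4 * (k + 2) ^ 2 + 6 * (k + 2))) * q + q := by
    rw [hM]; ring
  linarith

/-- Minimum principle for supersolutions of at most Gaussian growth. -/
theorem nonneg_of_supersolution (hν : 0 ≤ ν) (hl : 0 ≤ l)
    (hcont : ContinuousOn (fun p : E3 × E3 × ℝ => f p.1 p.2.1 p.2.2) {p | 0 ≤ p.2.2})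
    (hgrowth : HasGaussianGrowth f)
    (hft : ∀ w x t, 0 < t → HasDerivAt (fun s => f w x s) (ft w x t) t)
    (hfx : ∀ i w x t, 0 < t →
      HasDerivAt (fun s : ℝ => f w (x + s • unitVec i) t) (fx i w x t) 0)
    (hfxx : ∀ i w x t, 0 < t →
      HasDerivAt (fun s : ℝ => fx i w (x + s • unitVec i) t) (fxx i w x t) 0)
    (hfw : ∀ i w x t, 0 < t →
      HasDerivAt (fun s : ℝ => f (w + s • unitVec i) x t) (fw i w x t) 0)
    (hsuper : ∀ w x t, 0 < t → f w x t < 0 →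
      0 ≤ ft w x t + ∑ i, b x w t i * fx i w x t - ν * ∑ i, fxx i w x t
        - ∑ i, a x w t i * fw i w x t - l * f w x t)
    (ha : ∀ T, ∃ β, ∀ w x t, 0 ≤ t → t ≤ T →
      |∑ i, a x w t i * w i| ≤ β * (1 + ‖x‖ ^ 2 + ‖w‖ ^ 2))
    (hb : ∀ T, ∃ β, ∀ w x t, 0 ≤ t → t ≤ T →
      |∑ i, b x w t i * x i| ≤ β * (1 + ‖x‖ ^ 2 + ‖w‖ ^ 2))
    (h0 : ∀ w x, 0 ≤ f w x 0) : ∀ w x t, 0 ≤ t → 0 ≤ f w x t := by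
  intro w₁ x₁ T hT
  obtain ⟨C, k, hCk⟩ := hgrowth T
  obtain ⟨β₁, hβ₁⟩ := ha T
  obtain ⟨β₂, hβ₂⟩ := hb T
  obtain ⟨M, hM⟩ : ∃ M, M = 4 * (|k| + 2) * (|β₁| + |β₂|) +
    ν * (4 * (|k| + 2) ^ 2 + 6 * (|k| + 2)) + 1 := ⟨_, rfl⟩
  have hMpos : 0 < M := by rw [hM]; positivity
  -- The constants `C`, `k`, `β₁`, `β₂` serve all of `[0, T]`, so every slab may have the same
  -- length `1 / M` and finitely many reach `T`.
  have key : ∀ n : ℕ, ∀ w x t, 0 ≤ t → t ≤ T → t ≤ n / M → 0 ≤ f w x t := by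
    intro n
    induction n with
    | zero =>
      intro w x t h1 _ h3
      have : t = 0 := le_antisymm (by simpa using h3) h1
      rw [this]; exact h0 w x
    | succ n ih =>
      intro w x t h1 h2 h3
      by_cases h4 : t ≤ n / M
      · exact ih w x t h1 h2 h4
      push Not at h4
      have hn : 0 ≤ (n : ℝ) / M := by positivity
      refine nonneg_of_supersolution_slab hν hl hcont hft hfx hfxx hfw hsuper (t₀ := n / M)
        (t₁ := t) (C := |C|) (k := |k|) (β := |β₁| + |β₂|) (M := M) hn (abs_nonneg _)
        (abs_nonneg _) (by positivity) ?_ ?_ ?_ hM ?_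
        (fun w x => ih w x _ hn (h4.le.trans h2) le_rfl) w x t h4.le le_rfl
      · intro w x t h5 h6
        refine (hCk w x t (hn.trans h5) (h6.trans h2)).trans ?_
        gcongr
        · exact le_abs_self C
        · exact le_abs_self k
      · intro w x t h5 h6
        refine (hβ₁ w x t (hn.trans h5) (h6.trans h2)).trans ?_
        gcongr
        linarith [le_abs_self β₁, abs_nonneg β₂]
      · intro w x t h5 h6
        refine (hβ₂ w x t (hn.trans h5) (h6.trans h2)).trans ?_
        gcongr
        linarith [le_abs_self β₂, abs_nonneg β₁]
      · rw [mul_sub, mul_div_cancel₀ _ hMpos.ne']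
        have := mul_le_mul_of_nonneg_left h3 hMpos.le
        rw [mul_div_cancel₀ _ hMpos.ne'] at this
        push_cast at this
        linarith
  obtain ⟨n, hn⟩ := exists_nat_ge (T * M)
  exact key n w₁ x₁ T hT le_rfl (by rwa [le_div_iff₀ hMpos])

end MaximumPrinciple

/-! ### Differentiation under the integral, the product rule with error, the divergence theorem -/

theorem norm_unitVec (i : Fin 3) : ‖unitVec i‖ = 1 := by simp [unitVec]

/-- Differentiation under the integral sign over `ℝ³`. -/
theorem hasDerivAt_integral_of_dominated {F F' : E3 → ℝ → ℝ} {bound : E3 → ℝ} {s₀ δ : ℝ}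
    (hδ : 0 < δ) (hcont : ∀ s ∈ Metric.ball s₀ δ, Continuous (fun w => F w s))
    (hint : Integrable (fun w => F w s₀))
    (hderiv : ∀ w, ∀ s ∈ Metric.ball s₀ δ, HasDerivAt (F w) (F' w s) s)
    (hbound : ∀ w, ∀ s ∈ Metric.ball s₀ δ, |F' w s| ≤ bound w) (hb : Integrable bound) :
    Integrable (fun w => F' w s₀) ∧
      HasDerivAt (fun s => ∫ w, F w s) (∫ w, F' w s₀) s₀ := by
  have hs₀ : s₀ ∈ Metric.ball s₀ δ := Metric.mem_ball_self hδ
  -- The derivative is a pointwise limit of difference quotients continuous in `w`, so its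
  -- measurability need not be assumed.
  have hmeas : AEStronglyMeasurable (fun w => F' w s₀) volume := by
    have hseq : Filter.Tendsto (fun n : ℕ => s₀ + δ / 2 * (1 / ((n : ℝ) + 1))) Filter.atTop
        (nhdsWithin s₀ {s₀}ᶜ) := by
      refine tendsto_nhdsWithin_iff.2 ⟨?_, Filter.Eventually.of_forall fun n => ?_⟩
      · have := (tendsto_one_div_add_atTop_nhds_zero_nat (𝕜 := ℝ)).const_mul (δ / 2)
        simpa using this.const_add s₀
      · have : 0 < δ / 2 * (1 / ((n : ℝ) + 1)) := by positivity
        simp only [Set.mem_compl_iff, Set.mem_singleton_iff]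
        linarith
    refine aestronglyMeasurable_of_tendsto_ae Filter.atTop
      (f := fun (n : ℕ) w => slope (F w) s₀ (s₀ + δ / 2 * (1 / ((n : ℝ) + 1)))) (fun n => ?_)
      (Filter.Eventually.of_forall fun w =>
        (hasDerivAt_iff_tendsto_slope.1 (hderiv w s₀ hs₀)).comp hseq)
    have hmem : s₀ + δ / 2 * (1 / ((n : ℝ) + 1)) ∈ Metric.ball s₀ δ := by
      rw [Metric.mem_ball, Real.dist_eq, add_sub_cancel_left, abs_of_nonneg (by positivity)]
      have : 1 / ((n : ℝ) + 1) ≤ 1 := by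
        rw [div_le_one (by positivity)]; linarith [n.cast_nonneg (α := ℝ)]
      nlinarith
    simp only [slope_def_field]
    exact (((hcont _ hmem).sub (hcont _ hs₀)).div_const _).aestronglyMeasurable
  exact hasDerivAt_integral_of_dominated_loc_of_deriv_le (F := fun s w => F w s)
    (F' := fun s w => F' w s) (Metric.ball_mem_nhds s₀ hδ)
    (Filter.eventually_of_mem (Metric.ball_mem_nhds s₀ hδ) fun s hs =>
      (hcont s hs).aestronglyMeasurable) hint hmeas
    (Filter.Eventually.of_forall fun w s hs => hbound w s hs) hb
    (Filter.Eventually.of_forall fun w s hs => hderiv w s hs)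

/-- The product rule for a product whose second factor is merely Lipschitz holds up to the
obvious error. -/
theorem abs_sub_le_of_hasDerivAt_mul {p q : ℝ → ℝ} {p' d : ℝ} {L : ℝ}
    (hp : HasDerivAt p p' 0) (hpq : HasDerivAt (fun s => p s * q s) d 0)
    (hq : ∀ s, |q s - q 0| ≤ L * |s|) : |d - p' * q 0| ≤ L * |p 0| := by
  have hqc : Filter.Tendsto q (nhdsWithin 0 {0}ᶜ) (nhds (q 0)) := by
    refine Filter.Tendsto.mono_left ?_ nhdsWithin_le_nhds
    rw [tendsto_iff_dist_tendsto_zero]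
    refine squeeze_zero (g := fun s => L * |s|) (fun _ => dist_nonneg) hq ?_
    have : Continuous fun s : ℝ => L * |s| := by fun_prop
    simpa using this.tendsto 0
  have h := ((hasDerivAt_iff_tendsto_slope.1 hpq).sub
    ((hasDerivAt_iff_tendsto_slope.1 hp).mul hqc)).abs
  refine le_of_tendsto h ?_
  filter_upwards [self_mem_nhdsWithin] with s hs
  have hs0 : s ≠ 0 := hs
  -- Pairing the slope of `p` with `q s` rather than `q 0` makes the error exactly `p 0` times a
  -- difference quotient of `q`, which is at most `L` in size.
  have : slope (fun s => p s * q s) 0 s - slope p 0 s * q s = p 0 * ((q s - q 0) / s) := by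
    simp only [slope_def_field, sub_zero]; field_simp; ring
  rw [this, abs_mul, abs_div, mul_comm]
  refine mul_le_mul_of_nonneg_right ?_ (abs_nonneg _)
  rw [div_le_iff₀ (abs_pos.2 hs0)]
  exact hq s

/-- The divergence theorem on `ℝ³`: an integrable field with integrable divergence has
divergence of mean zero. -/
theorem integral_sum_lineDeriv_eq_zero {G : Fin 3 → E3 → ℝ} {H : E3 → ℝ}
    (hG : ∀ i, Continuous (G i)) (hint : ∀ i, Integrable (G i))
    (hd : ∀ i w, LineDifferentiableAt ℝ (G i) w (unitVec i)) (hH : Continuous H)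
    (hbd : ∀ i w, |lineDeriv ℝ (G i) w (unitVec i)| ≤ H w)
    (hsum : Integrable (fun w => ∑ i, lineDeriv ℝ (G i) w (unitVec i))) :
    ∫ w, ∑ i, lineDeriv ℝ (G i) w (unitVec i) = 0 := by
  -- The cutoffs `χ (c n • w)` increase their scale to infinity while their gradients are at most `c
  -- n * D`, which tends to zero.
  let χ : ContDiffBump (0 : E3) := ⟨1, 2, one_pos, one_lt_two⟩
  have hχ : ContDiff ℝ 1 (χ : E3 → ℝ) := χ.contDiff
  have hχ' : Continuous (fderiv ℝ (χ : E3 → ℝ)) := hχ.continuous_fderiv one_ne_zero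
  have hχs : HasCompactSupport (fderiv ℝ (χ : E3 → ℝ)) := χ.hasCompactSupport.fderiv ℝ
  obtain ⟨D, hD⟩ := hχs.exists_bound_of_continuous hχ'
  let c : ℕ → ℝ := fun n => 1 / ((n : ℝ) + 1)
  have hc : ∀ n, 0 < c n := fun n => by simp only [c]; positivity
  have hclim : Filter.Tendsto c Filter.atTop (nhds 0) := tendsto_one_div_add_atTop_nhds_zero_nat
  let χn : ℕ → E3 → ℝ := fun n w => χ (c n • w)
  have hχnc : ∀ n, Continuous (χn n) := fun n => χ.continuous.comp (continuous_const_smul _)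
  have hχns : ∀ n, HasCompactSupport (χn n) := fun n =>
    χ.hasCompactSupport.comp_smul (hc n).ne'
  have hχnd : ∀ n w i, HasLineDerivAt ℝ (χn n)
      (c n * fderiv ℝ (χ : E3 → ℝ) (c n • w) (unitVec i)) w (unitVec i) := by
    intro n w i
    have h1 : HasFDerivAt (χ : E3 → ℝ) (fderiv ℝ (χ : E3 → ℝ) (c n • w)) (c n • w) :=
      (hχ.differentiable one_ne_zero _).hasFDerivAt
    have h2 : HasFDerivAt (fun w : E3 => c n • w) (c n • ContinuousLinearMap.id ℝ E3) w :=
      (hasFDerivAt_id w).const_smul (c n)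
    have := (h1.comp w h2).hasLineDerivAt (unitVec i)
    simp only [ContinuousLinearMap.comp_smul, ContinuousLinearMap.comp_id,
      smul_apply, smul_eq_mul] at this
    exact this
  have hLm : ∀ i, Measurable fun w => lineDeriv ℝ (G i) w (unitVec i) := fun i =>
    measurable_lineDeriv (hG i)
  -- The single derivatives need not be integrable, only their sum. The continuous majorant `H`
  -- makes them integrable after cutoff, which suffices to integrate by parts in each direction.
  have hi1 : ∀ n i, Integrable fun w => χn n w * lineDeriv ℝ (G i) w (unitVec i) := by
    intro n i
    have h0 : Integrable fun w => χn n w * H w :=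
      ((hχnc n).mul hH).integrable_of_hasCompactSupport (hχns n).mul_right
    refine h0.mono ((hχnc n).measurable.mul (hLm i)).aestronglyMeasurable
      (Filter.Eventually.of_forall fun w => ?_)
    rw [norm_mul, norm_mul]
    gcongr
    exact (hbd i w).trans (le_abs_self _)
  have hb2 : ∀ n w i, |c n * fderiv ℝ (χ : E3 → ℝ) (c n • w) (unitVec i)| ≤ c n * D := by
    intro n w i
    rw [abs_mul, abs_of_pos (hc n)]
    refine mul_le_mul_of_nonneg_left ?_ (hc n).le
    refine ((fderiv ℝ (χ : E3 → ℝ) (c n • w)).le_opNorm _).trans ?_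
    rw [norm_unitVec, mul_one]; exact hD _
  have hi2 : ∀ n i, Integrable fun w =>
      c n * fderiv ℝ (χ : E3 → ℝ) (c n • w) (unitVec i) * G i w := by
    intro n i
    refine (hint i).bdd_mul (c := c n * D) ?_ (Filter.Eventually.of_forall fun w => hb2 n w i)
    exact Continuous.aestronglyMeasurable (by fun_prop)
  have hi3 : ∀ n i, Integrable fun w => χn n w * G i w := fun n i =>
    ((hχnc n).mul (hG i)).integrable_of_hasCompactSupport (hχns n).mul_right
  have hibp : ∀ n, ∫ w, χn n w * ∑ i, lineDeriv ℝ (G i) w (unitVec i) =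
      -∑ i, ∫ w, c n * fderiv ℝ (χ : E3 → ℝ) (c n • w) (unitVec i) * G i w := by
    intro n
    simp_rw [Finset.mul_sum]
    rw [integral_finsetSum _ fun i _ => hi1 n i, ← Finset.sum_neg_distrib]
    refine Finset.sum_congr rfl fun i _ => ?_
    exact integral_bilinear_hasLineDerivAt_right_eq_neg_left_of_integrable
      (B := ContinuousLinearMap.mul ℝ ℝ) (hi2 n i) (hi1 n i) (hi3 n i)
      (fun w _ => hχnd n w i) (fun w _ => (hd i w).hasLineDerivAt)
  have hlim0 : Filter.Tendsto (fun n => ∫ w, χn n w * ∑ i, lineDeriv ℝ (G i) w (unitVec i))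
      Filter.atTop (nhds 0) := by
    refine squeeze_zero_norm (a := fun n => c n * (D * ∑ i, ∫ w, |G i w|)) (fun n => ?_) ?_
    · rw [hibp, norm_neg, ← mul_assoc, Finset.mul_sum]
      refine (norm_sum_le _ _).trans (Finset.sum_le_sum fun i _ => ?_)
      rw [← integral_const_mul]
      refine norm_integral_le_of_norm_le ((hint i).abs.const_mul _)
        (Filter.Eventually.of_forall fun w => ?_)
      rw [norm_mul]
      exact mul_le_mul_of_nonneg_right (hb2 n w i) (abs_nonneg _)
    · simpa using hclim.mul_const (D * ∑ i, ∫ w, |G i w|)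
  -- Dominated convergence is applied to the sum as a whole, with its own norm as majorant.
  have hlim1 : Filter.Tendsto (fun n => ∫ w, χn n w * ∑ i, lineDeriv ℝ (G i) w (unitVec i))
      Filter.atTop (nhds (∫ w, ∑ i, lineDeriv ℝ (G i) w (unitVec i))) := by
    refine tendsto_integral_of_dominated_convergence
      (fun w => ‖∑ i, lineDeriv ℝ (G i) w (unitVec i)‖)
      (fun n => (hχnc n).aestronglyMeasurable.mul hsum.aestronglyMeasurable) hsum.norm
      (fun n => Filter.Eventually.of_forall fun w => ?_)
      (Filter.Eventually.of_forall fun w => ?_)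
    · rw [norm_mul]
      refine mul_le_of_le_one_left (norm_nonneg _) ?_
      rw [Real.norm_of_nonneg χ.nonneg]; exact χ.le_one
    · have h1 : Filter.Tendsto (fun n => c n • w) Filter.atTop (nhds 0) := by
        simpa using hclim.smul_const w
      have h2 : Filter.Tendsto (fun n => χn n w) Filter.atTop (nhds 1) := by
        have := (χ.continuous.tendsto 0).comp h1
        rwa [χ.one_of_mem_closedBall (Metric.mem_closedBall_self χ.rIn_pos.le)] at this
      simpa using h2.mul_const (∑ i, lineDeriv ℝ (G i) w (unitVec i))
  exact tendsto_nhds_unique hlim1 hlim0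

/-! ### Growth of Lipschitz fields -/

namespace IsLipschitzField

variable {V : E3 → E3 → ℝ → E3}

theorem continuous (hV : IsLipschitzField V) {t : ℝ} (ht : 0 ≤ t) :
    Continuous (fun p : E3 × E3 => V p.1 p.2 t) := by
  obtain ⟨L, hL⟩ := hV.lipschitz
  exact (hL t ht).continuous

theorem exists_norm_le (hV : IsLipschitzField V) (T : ℝ) : ∃ β, 0 ≤ β ∧ ∀ x w t, 0 ≤ t → t ≤ T →
    ‖V x w t‖ ≤ β * (1 + ‖x‖ + ‖w‖) := by
  obtain ⟨L, hL⟩ := hV.lipschitz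
  obtain ⟨K, hK⟩ := hV.bounded_at_zero T
  refine ⟨L + |K|, by positivity, fun x w t h0 hT => ?_⟩
  have h1 := (hL t h0).dist_le_mul (x, w) (0, 0)
  simp only [dist_eq_norm, Prod.mk_sub_mk, sub_zero, Prod.norm_mk] at h1
  have h2 : ‖V x w t‖ ≤ ‖V x w t - V 0 0 t‖ + ‖V 0 0 t‖ := by
    simpa using norm_add_le (V x w t - V 0 0 t) (V 0 0 t)
  have h3 : max ‖x‖ ‖w‖ ≤ ‖x‖ + ‖w‖ := max_le_add_of_nonneg (norm_nonneg _) (norm_nonneg _)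
  have h4 := mul_le_mul_of_nonneg_left h3 L.coe_nonneg
  have h5 : 0 ≤ |K| * (‖x‖ + ‖w‖) := by positivity
  have h6 : ‖V 0 0 t‖ ≤ |K| := (hK t h0 hT).trans (le_abs_self _)
  linarith [L.coe_nonneg]

/-- Linear growth and Cauchy–Schwarz. These radial components are all that the barrier sees of the
drift, since its gradient is radial in `x` and in `w`. -/
theorem exists_abs_sum_mul_le (hV : IsLipschitzField V) (T : ℝ) : ∃ β, ∀ x w t, 0 ≤ t → t ≤ T →
    |∑ i, V x w t i * x i| ≤ β * (1 + ‖x‖ ^ 2 + ‖w‖ ^ 2) ∧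
    |∑ i, V x w t i * w i| ≤ β * (1 + ‖x‖ ^ 2 + ‖w‖ ^ 2) := by
  obtain ⟨β, hβ, h⟩ := hV.exists_norm_le T
  have key : ∀ v z : E3, |∑ i, v i * z i| ≤ ‖v‖ * ‖z‖ := fun v z => by
    have := abs_real_inner_le_norm z v
    rw [PiLp.inner_apply] at this
    simpa [mul_comm] using this
  refine ⟨3 * β, fun x w t h0 hT => ⟨?_, ?_⟩⟩
  · refine (key _ _).trans ((mul_le_mul_of_nonneg_right (h x w t h0 hT) (norm_nonneg x)).trans ?_)
    have : (1 + ‖x‖ + ‖w‖) * ‖x‖ ≤ 3 * (1 + ‖x‖ ^ 2 + ‖w‖ ^ 2) := by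
      nlinarith [sq_nonneg (‖x‖ - ‖w‖), sq_nonneg (‖x‖ - 1), sq_nonneg ‖w‖, sq_nonneg ‖x‖]
    nlinarith
  · refine (key _ _).trans ((mul_le_mul_of_nonneg_right (h x w t h0 hT) (norm_nonneg w)).trans ?_)
    have : (1 + ‖x‖ + ‖w‖) * ‖w‖ ≤ 3 * (1 + ‖x‖ ^ 2 + ‖w‖ ^ 2) := by
      nlinarith [sq_nonneg (‖x‖ - ‖w‖), sq_nonneg (‖w‖ - 1), sq_nonneg ‖w‖, sq_nonneg ‖x‖]
    nlinarith

end IsLipschitzField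

theorem lipschitzWith_apply {V : E3 → E3} {L : ℝ≥0} (hV : LipschitzWith L V) (i : Fin 3) :
    LipschitzWith L (fun y => V y i) := by
  refine LipschitzWith.of_dist_le_mul fun x y => ?_
  refine le_trans ?_ (hV.dist_le_mul x y)
  rw [dist_eq_norm, dist_eq_norm]
  exact PiLp.norm_apply_le (V x - V y) i

/-! ### Classical solutions and preservation of non-negativity -/

namespace IsClassicalSolution

variable {ν : ℝ} {A B : E3 → E3 → ℝ → E3} {f : E3 → E3 → ℝ → ℝ}

theorem continuous_w (hf : IsClassicalSolution ν A B f) (x : E3) {t : ℝ} (ht : 0 ≤ t) :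
    Continuous (fun w => f w x t) :=
  hf.continuousOn.comp_continuous (f := fun w : E3 => (w, x, t)) (by fun_prop) fun _ => ht

theorem continuous_fderiv_w (hf : IsClassicalSolution ν A B f) (x : E3) {t : ℝ} (ht : 0 < t) :
    Continuous (fun w => fderiv ℝ (fun y : E3 => f w y t) x) :=
  hf.continuousOn_x.comp_continuous (f := fun w : E3 => (w, x, t)) (by fun_prop) fun _ => ht

theorem hasDerivAt_t (hf : IsClassicalSolution ν A B f) (w x : E3) {t : ℝ} (ht : 0 < t) :
    HasDerivAt (fun s => f w x s) (deriv (fun s => f w x s) t) t :=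
  (hf.differentiable_t w x t ht).hasDerivAt

theorem hasDerivAt_x (hf : IsClassicalSolution ν A B f) (i : Fin 3) (w x : E3) {t : ℝ}
    (ht : 0 < t) : HasDerivAt (fun s : ℝ => f w (x + s • unitVec i) t)
      (fderiv ℝ (fun y => f w y t) x (unitVec i)) 0 :=
  (((hf.contDiff_x w t ht).differentiable two_ne_zero x).hasFDerivAt).hasLineDerivAt (unitVec i)

theorem hasDerivAt_w (hf : IsClassicalSolution ν A B f) (i : Fin 3) (w x : E3) {t : ℝ}
    (ht : 0 < t) : HasDerivAt (fun s : ℝ => f (w + s • unitVec i) x t)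
      (fderiv ℝ (fun v => f v x t) w (unitVec i)) 0 :=
  (((hf.contDiff_w x t ht).differentiable one_ne_zero w).hasFDerivAt).hasLineDerivAt (unitVec i)

theorem hasDerivAt_xx (hf : IsClassicalSolution ν A B f) (i : Fin 3) (w x : E3) {t : ℝ}
    (ht : 0 < t) :
    HasDerivAt (fun s : ℝ => fderiv ℝ (fun y => f w y t) (x + s • unitVec i) (unitVec i))
      (iteratedFDeriv ℝ 2 (fun y => f w y t) x ![unitVec i, unitVec i]) 0 := by
  have h1 : ContDiff ℝ 1 (fderiv ℝ (fun y => f w y t)) :=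
    (hf.contDiff_x w t ht).fderiv_right (by norm_num)
  have h2 := ((h1.differentiable one_ne_zero x).hasFDerivAt).hasLineDerivAt (unitVec i)
  rw [iteratedFDeriv_two_apply]
  have h3 : HasDerivAt (fun s : ℝ => fderiv ℝ (fun y => f w y t) (x + s • unitVec i))
    (fderiv ℝ (fderiv ℝ (fun y => f w y t)) x (unitVec i)) 0 := h2
  simpa using h3.clm_apply (hasDerivAt_const 0 (unitVec i))

theorem laplacian_eq (f : E3 → ℝ) (x : E3) :
    Δ f x = ∑ i, iteratedFDeriv ℝ 2 f x ![unitVec i, unitVec i] := by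
  rw [InnerProductSpace.laplacian_eq_iteratedFDeriv_orthonormalBasis f
    (EuclideanSpace.basisFun (Fin 3) ℝ)]
  simp [unitVec]

theorem equation' (hf : IsClassicalSolution ν A B f) (w x : E3) {t : ℝ} (ht : 0 < t) :
    deriv (fun s : ℝ => f w x s) t
      + ∑ i, B x w t i * fderiv ℝ (fun y => f w y t) x (unitVec i)
      + divX B x w t * f w x t
      - ν * ∑ i, iteratedFDeriv ℝ 2 (fun y => f w y t) x ![unitVec i, unitVec i]
    = ∑ i, lineDeriv ℝ (fun v : E3 => f v x t * A x v t i) w (unitVec i) := by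
  rw [← hf.equation w x t ht, laplacian_eq]
  congr 4
  funext i
  rw [((hf.contDiff_x w t ht).differentiable two_ne_zero x).lineDeriv_eq_fderiv]

/-- This replaces the divergence form by transport `A · ∇_w f` plus a zeroth-order error, without
requiring `A` itself to be differentiable. -/
theorem abs_lineDeriv_mul_sub_le (hf : IsClassicalSolution ν A B f) {L : ℝ≥0}
    (hL : ∀ t : ℝ, 0 ≤ t → LipschitzWith L (fun p : E3 × E3 => A p.1 p.2 t))
    (i : Fin 3) (w x : E3) {t : ℝ} (ht : 0 < t) :
    |lineDeriv ℝ (fun v : E3 => f v x t * A x v t i) w (unitVec i)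
      - fderiv ℝ (fun v => f v x t) w (unitVec i) * A x w t i| ≤ L * |f w x t| := by
  have hlip : LipschitzWith L (fun v : E3 => A x v t i) := by
    refine lipschitzWith_apply (V := fun v => A x v t) ?_ i
    have := (hL t ht.le).comp (LipschitzWith.prodMk_left x)
    rwa [mul_one] at this
  have := abs_sub_le_of_hasDerivAt_mul (q := fun s : ℝ => A x (w + s • unitVec i) t i)
    (hf.hasDerivAt_w i w x ht)
    ((hf.differentiable_fA w x t ht i).hasLineDerivAt) (L := L) (fun s => ?_)
  · simpa using this
  · have := hlip.dist_le_mul (w + s • unitVec i) w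
    simpa [dist_eq_norm, norm_smul, norm_unitVec] using this

theorem abs_lineDeriv_le {L : ℝ≥0}
    (hL : ∀ t : ℝ, 0 ≤ t → LipschitzWith L (fun p : E3 × E3 => B p.1 p.2 t))
    (i : Fin 3) (w x : E3) {t : ℝ} (ht : 0 < t) :
    |lineDeriv ℝ (fun y : E3 => B y w t i) x (unitVec i)| ≤ L := by
  have hlip : LipschitzWith L (fun y : E3 => B y w t i) := by
    refine lipschitzWith_apply (V := fun y => B y w t) ?_ i
    have := (hL t ht.le).comp (LipschitzWith.prodMk_right w)
    rwa [mul_one] at this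
  simpa [norm_unitVec] using norm_lineDeriv_le_of_lipschitz ℝ (v := unitVec i) (x₀ := x) hlip

theorem abs_divX_le {L : ℝ≥0}
    (hL : ∀ t : ℝ, 0 ≤ t → LipschitzWith L (fun p : E3 × E3 => B p.1 p.2 t))
    (w x : E3) {t : ℝ} (ht : 0 < t) : |divX B x w t| ≤ 3 * L := by
  refine (Finset.abs_sum_le_sum_abs _ _).trans
    ((Finset.sum_le_sum fun i _ => abs_lineDeriv_le hL i w x ht).trans ?_)
  simp

/-- Classical solutions preserve non-negativity. -/
theorem nonneg (hν : 0 ≤ ν) (hA : IsLipschitzField A) (hB : IsLipschitzField B)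
    (hf : IsClassicalSolution ν A B f) (hgrowth : HasGaussianGrowth f)
    (h0 : ∀ w x, 0 ≤ f w x 0) : ∀ w x t, 0 ≤ t → 0 ≤ f w x t := by
  obtain ⟨LA, hLA⟩ := hA.lipschitz
  obtain ⟨LB, hLB⟩ := hB.lipschitz
  -- Each of the three directions costs one `LA` for the product rule error and one `LB` for
  -- `∂B^i/∂x^i`, whence `l`.
  refine nonneg_of_supersolution (a := fun x w t => A x w t) (b := B) (l := 3 * LA + 3 * LB)
    hν (by positivity) hf.continuousOn hgrowth
    (fun w x t ht => hf.hasDerivAt_t w x ht) (fun i w x t ht => hf.hasDerivAt_x i w x ht)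
    (fun i w x t ht => hf.hasDerivAt_xx i w x ht) (fun i w x t ht => hf.hasDerivAt_w i w x ht)
    ?_ (fun T => ?_) (fun T => ?_) h0
  · intro w x t ht hneg
    have e := hf.equation' w x ht
    have h1 := fun i => abs_le.1 (hf.abs_lineDeriv_mul_sub_le hLA i w x ht)
    have h2 : |divX B x w t * f w x t| ≤ 3 * LB * |f w x t| := by
      rw [abs_mul]; exact mul_le_mul_of_nonneg_right (abs_divX_le hLB w x ht) (abs_nonneg _)
    rw [abs_of_neg hneg] at h1 h2
    have h3 := abs_le.1 h2
    have h4 : -(3 * LA * -f w x t) ≤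
        ∑ i, lineDeriv ℝ (fun v : E3 => f v x t * A x v t i) w (unitVec i) -
        ∑ i, A x w t i * fderiv ℝ (fun v => f v x t) w (unitVec i) := by
      simp only [Fin.sum_univ_three]
      linarith [(h1 0).1, (h1 1).1, (h1 2).1]
    linarith [h3.2]
  · obtain ⟨β, hβ⟩ := hA.exists_abs_sum_mul_le T
    exact ⟨β, fun w x t h1 h2 => (hβ x w t h1 h2).2⟩
  · obtain ⟨β, hβ⟩ := hB.exists_abs_sum_mul_le T
    exact ⟨β, fun w x t h1 h2 => (hβ x w t h1 h2).1⟩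

end IsClassicalSolution

/-! ### The total mass and its equation -/

namespace DecaysFast

variable {ν : ℝ} {A B : E3 → E3 → ℝ → E3} {f : E3 → E3 → ℝ → ℝ}

theorem exp_mul_le {k r r' y : ℝ} (hr : 0 ≤ r) (hrr : r ≤ r') :
    Real.exp (k * r) * y ≤ Real.exp (|k| * r') * |y| := by
  refine (mul_le_mul_of_nonneg_left (le_abs_self y) (Real.exp_pos _).le).trans ?_
  refine mul_le_mul_of_nonneg_right (Real.exp_le_exp.2 ?_) (abs_nonneg y)
  exact (mul_le_mul_of_nonneg_right (le_abs_self k) hr).trans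
    (mul_le_mul_of_nonneg_left hrr (abs_nonneg k))

theorem exists_bound (hd : DecaysFast A B f) (T R : ℝ) : ∃ g : E3 → ℝ, Integrable g ∧
    ∀ w x t, 0 ≤ t → t ≤ T → ‖x‖ ≤ R → |f w x t| ≤ g w := by
  obtain ⟨k, g, hg, h⟩ := hd.decay T
  refine ⟨fun w => Real.exp (|k| * R ^ 2) * |g w|, hg.abs.const_mul _, fun w x t h0 hT hx => ?_⟩
  exact (h w x t h0 hT).trans (exp_mul_le (sq_nonneg _) (by gcongr))

theorem integrable (hd : DecaysFast A B f) (hf : IsClassicalSolution ν A B f) (x : E3) {t : ℝ}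
    (ht : 0 ≤ t) : Integrable (fun w => f w x t) := by
  obtain ⟨g, hg, h⟩ := hd.exists_bound t ‖x‖
  exact hg.mono' (hf.continuous_w x ht).aestronglyMeasurable
    (Filter.Eventually.of_forall fun w => h w x t ht le_rfl le_rfl)

theorem norm_add_smul_unitVec_le {x : E3} {s : ℝ} (hs : s ∈ Metric.ball (0 : ℝ) 1) (i : Fin 3) :
    ‖x + s • unitVec i‖ ≤ ‖x‖ + 1 := by
  refine (norm_add_le _ _).trans ?_
  rw [norm_smul, norm_unitVec, mul_one]
  have := mem_ball_zero_iff.1 hs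
  linarith

theorem hasDerivAt_integral_t (hd : DecaysFast A B f) (hf : IsClassicalSolution ν A B f) (x : E3)
    {t : ℝ} (ht : 0 < t) : Integrable (fun w => deriv (fun s => f w x s) t) ∧
      HasDerivAt (fun s => ∫ w, f w x s) (∫ w, deriv (fun s => f w x s) t) t := by
  -- The window contains the ball of radius `t / 2` about `t` and stays away from time zero, where
  -- the derivative bounds may fail.
  obtain ⟨g, hg, h⟩ := hd.decay_deriv (t / 2) (2 * t) ‖x‖ (by linarith)
  have hball : ∀ s ∈ Metric.ball t (t / 2), t / 2 < s ∧ s < 2 * t := fun s hs => by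
    rw [Real.ball_eq_Ioo] at hs; exact ⟨by linarith [hs.1], by linarith [hs.2]⟩
  refine hasDerivAt_integral_of_dominated (F := fun w s => f w x s)
    (F' := fun w s => deriv (fun s => f w x s) s) (half_pos ht)
    (fun s hs => hf.continuous_w x (by linarith [hball s hs]))
    (hd.integrable hf x ht.le) (fun w s hs => hf.hasDerivAt_t w x (by linarith [hball s hs]))
    (fun w s hs => ?_) hg
  exact (h w x s (hball s hs).1.le (hball s hs).2.le le_rfl).2.2.1

theorem abs_fderiv_unitVec_le (hd : DecaysFast A B f) {t : ℝ} (ht : 0 < t) (R : ℝ) :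
    ∃ g : E3 → ℝ, Integrable g ∧ ∀ i w x, ‖x‖ ≤ R →
      |fderiv ℝ (fun y => f w y t) x (unitVec i)| ≤ g w ∧
      |B x w t i * fderiv ℝ (fun y => f w y t) x (unitVec i)| ≤ g w ∧
      |iteratedFDeriv ℝ 2 (fun y => f w y t) x ![unitVec i, unitVec i]| ≤ g w := by
  obtain ⟨g, hg, h⟩ := hd.decay_deriv t t R ht
  refine ⟨g, hg, fun i w x hx => ?_⟩
  obtain ⟨-, -, -, h1, h2⟩ := h w x t le_rfl le_rfl hx
  have h3 : |fderiv ℝ (fun y => f w y t) x (unitVec i)| ≤ ‖fderiv ℝ (fun y => f w y t) x‖ := by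
    simpa [norm_unitVec] using (fderiv ℝ (fun y => f w y t) x).le_opNorm (unitVec i)
  have h4 : |B x w t i| ≤ ‖B x w t‖ := PiLp.norm_apply_le (B x w t) i
  have h5 : 0 ≤ ‖B x w t‖ * ‖fderiv ℝ (fun y => f w y t) x‖ := by positivity
  refine ⟨?_, ?_, ?_⟩
  · linarith
  · rw [abs_mul]
    have := mul_le_mul h4 h3 (abs_nonneg _) (norm_nonneg _)
    linarith [norm_nonneg (fderiv ℝ (fun y => f w y t) x)]
  · refine le_trans ?_ h2
    have := (iteratedFDeriv ℝ 2 (fun y => f w y t) x).le_opNorm ![unitVec i, unitVec i]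
    simpa [Fin.prod_univ_two, norm_unitVec] using this

theorem hasDerivAt_integral_x (hd : DecaysFast A B f) (hf : IsClassicalSolution ν A B f)
    (i : Fin 3) (x : E3) {t : ℝ} (ht : 0 < t) :
    Integrable (fun w => fderiv ℝ (fun y => f w y t) x (unitVec i)) ∧
      HasDerivAt (fun s : ℝ => ∫ w, f w (x + s • unitVec i) t)
        (∫ w, fderiv ℝ (fun y => f w y t) x (unitVec i)) 0 := by
  obtain ⟨g, hg, h⟩ := hd.abs_fderiv_unitVec_le ht (‖x‖ + 1)
  have := hasDerivAt_integral_of_dominated (F := fun w s => f w (x + s • unitVec i) t)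
    (F' := fun w s => fderiv ℝ (fun y => f w y t) (x + s • unitVec i) (unitVec i)) (s₀ := 0)
    one_pos (fun s _ => hf.continuous_w _ ht.le)
    (hd.integrable hf _ ht.le)
    (fun w s _ => hasDerivAt_along_unitVec (h := fun y => f w y t)
      (h' := fun y => fderiv ℝ (fun y => f w y t) y (unitVec i))
      (fun y => hf.hasDerivAt_x i w y ht) x s)
    (fun w s hs => (h i w _ (norm_add_smul_unitVec_le hs i)).1) hg
  simpa using this

theorem hasDerivAt_integral_xx (hd : DecaysFast A B f) (hf : IsClassicalSolution ν A B f)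
    (i : Fin 3) (x : E3) {t : ℝ} (ht : 0 < t) :
    Integrable (fun w => iteratedFDeriv ℝ 2 (fun y => f w y t) x ![unitVec i, unitVec i]) ∧
      HasDerivAt (fun s : ℝ => ∫ w, fderiv ℝ (fun y => f w y t) (x + s • unitVec i) (unitVec i))
        (∫ w, iteratedFDeriv ℝ 2 (fun y => f w y t) x ![unitVec i, unitVec i]) 0 := by
  obtain ⟨g, hg, h⟩ := hd.abs_fderiv_unitVec_le ht (‖x‖ + 1)
  have := hasDerivAt_integral_of_dominated
    (F := fun w s => fderiv ℝ (fun y => f w y t) (x + s • unitVec i) (unitVec i))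
    (F' := fun w s => iteratedFDeriv ℝ 2 (fun y => f w y t) (x + s • unitVec i)
      ![unitVec i, unitVec i]) (s₀ := 0)
    one_pos (fun s _ => (hf.continuous_fderiv_w _ ht).clm_apply continuous_const)
    (hd.hasDerivAt_integral_x hf i _ ht).1
    (fun w s _ => hasDerivAt_along_unitVec
      (h := fun y => fderiv ℝ (fun y => f w y t) y (unitVec i))
      (h' := fun y => iteratedFDeriv ℝ 2 (fun y => f w y t) y ![unitVec i, unitVec i])
      (fun y => hf.hasDerivAt_xx i w y ht) x s)
    (fun w s hs => (h i w _ (norm_add_smul_unitVec_le hs i)).2.2) hg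
  simpa using this

/-- The Lipschitz constant bounds the derivative of `B`, so the first term is dominated through the
decay of `f` alone; the weight `1 + ‖B‖` in the decay hypothesis dominates the second. -/
theorem hasDerivAt_integral_flux (hd : DecaysFast A B f) (hf : IsClassicalSolution ν A B f)
    (hB : IsLipschitzField B) (i : Fin 3) (x : E3) {t : ℝ} (ht : 0 < t) :
    Integrable (fun w => lineDeriv ℝ (fun y => B y w t i) x (unitVec i) * f w x t
        + B x w t i * fderiv ℝ (fun y => f w y t) x (unitVec i)) ∧
      HasDerivAt (fun s : ℝ => ∫ w, B (x + s • unitVec i) w t i * f w (x + s • unitVec i) t)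
        (∫ w, (lineDeriv ℝ (fun y => B y w t i) x (unitVec i) * f w x t
          + B x w t i * fderiv ℝ (fun y => f w y t) x (unitVec i))) 0 := by
  obtain ⟨g, hg, h⟩ := hd.abs_fderiv_unitVec_le ht (‖x‖ + 1)
  obtain ⟨g', hg', h'⟩ := hd.exists_bound t (‖x‖ + 1)
  obtain ⟨g₀, hg₀, h₀⟩ := hd.decay_deriv t t ‖x‖ ht
  obtain ⟨L, hL⟩ := hB.lipschitz
  have hBc : ∀ y, Continuous fun w => B y w t i := fun y => by
    have := (hB.continuous ht.le).comp (Continuous.prodMk_right y)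
    exact (EuclideanSpace.proj i).continuous.comp this
  have hd' : ∀ w y, HasDerivAt (fun s : ℝ => B (y + s • unitVec i) w t i *
      f w (y + s • unitVec i) t)
      (lineDeriv ℝ (fun y => B y w t i) y (unitVec i) * f w y t
        + B y w t i * fderiv ℝ (fun y => f w y t) y (unitVec i)) 0 := fun w y => by
    have h1 : HasDerivAt (fun s : ℝ => B (y + s • unitVec i) w t i)
      (lineDeriv ℝ (fun y => B y w t i) y (unitVec i)) 0 :=
      (hf.differentiable_B w y t ht i).hasLineDerivAt
    have h2 := h1.mul (hf.hasDerivAt_x i w y ht)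
    simp only [zero_smul, add_zero] at h2
    exact h2
  have := hasDerivAt_integral_of_dominated
    (F := fun w s => B (x + s • unitVec i) w t i * f w (x + s • unitVec i) t)
    (F' := fun w s => lineDeriv ℝ (fun y => B y w t i) (x + s • unitVec i) (unitVec i)
        * f w (x + s • unitVec i) t + B (x + s • unitVec i) w t i *
        fderiv ℝ (fun y => f w y t) (x + s • unitVec i) (unitVec i)) (s₀ := 0)
    (bound := fun w => L * g' w + g w)
    one_pos (fun s _ => (hBc _).mul (hf.continuous_w _ ht.le)) ?_
    (fun w s _ => hasDerivAt_along_unitVec (h := fun y => B y w t i * f w y t)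
      (h' := fun y => lineDeriv ℝ (fun y => B y w t i) y (unitVec i) * f w y t
        + B y w t i * fderiv ℝ (fun y => f w y t) y (unitVec i)) (fun y => hd' w y) x s)
    (fun w s hs => ?_) ((hg'.const_mul _).add hg)
  · simpa using this
  · simp only [zero_smul, add_zero]
    refine hg₀.mono' ((hBc x).mul (hf.continuous_w x ht.le)).aestronglyMeasurable
      (Filter.Eventually.of_forall fun w => ?_)
    rw [norm_mul, mul_comm]
    refine le_trans ?_ (h₀ w x t le_rfl le_rfl le_rfl).2.1
    exact mul_le_mul_of_nonneg_left (PiLp.norm_apply_le (B x w t) i) (abs_nonneg _)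
  · have hs' := norm_add_smul_unitVec_le (x := x) hs i
    refine (abs_add_le _ _).trans (add_le_add ?_ (h i w _ hs').2.1)
    rw [abs_mul]
    exact mul_le_mul (IsClassicalSolution.abs_lineDeriv_le hL i w _ ht)
      (h' w _ t ht.le le_rfl hs') (abs_nonneg _) L.coe_nonneg

/-- The equation integrated over `w`. -/
theorem integrated_equation (hd : DecaysFast A B f) (hf : IsClassicalSolution ν A B f)
    (hA : IsLipschitzField A) (hB : IsLipschitzField B) (x : E3) {t : ℝ} (ht : 0 < t) :
    (∫ w, deriv (fun s => f w x s) t)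
      + (∑ i, ∫ w, (lineDeriv ℝ (fun y => B y w t i) x (unitVec i) * f w x t
          + B x w t i * fderiv ℝ (fun y => f w y t) x (unitVec i)))
      - ν * ∑ i, ∫ w, iteratedFDeriv ℝ 2 (fun y => f w y t) x ![unitVec i, unitVec i] = 0 := by
  obtain ⟨L, hL⟩ := hA.lipschitz
  obtain ⟨g, hg, h⟩ := hd.decay_deriv t t ‖x‖ ht
  have i1 := (hd.hasDerivAt_integral_t hf x ht).1
  have i2 := fun i => (hd.hasDerivAt_integral_flux hf hB i x ht).1
  have i3 := fun i => (hd.hasDerivAt_integral_xx hf i x ht).1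
  have i2' := integrable_finsetSum Finset.univ fun i _ => i2 i
  have i3' := (integrable_finsetSum Finset.univ fun i _ => i3 i).const_mul ν
  -- Solved for the divergence in `w`, the equation shows that this divergence is integrable,
  -- although no decay of the `w`-derivatives of `f` is assumed.
  have heq : ∀ w, ∑ i, lineDeriv ℝ (fun v : E3 => f v x t * A x v t i) w (unitVec i) =
      deriv (fun s => f w x s) t + ∑ i, (lineDeriv ℝ (fun y => B y w t i) x (unitVec i) * f w x t
          + B x w t i * fderiv ℝ (fun y => f w y t) x (unitVec i))
      - ν * ∑ i, iteratedFDeriv ℝ 2 (fun y => f w y t) x ![unitVec i, unitVec i] := by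
    intro w
    rw [← hf.equation' w x ht, Finset.sum_add_distrib, ← Finset.sum_mul, divX]
    ring
  have hAc : Continuous fun w => A x w t :=
    (hA.continuous ht.le).comp (Continuous.prodMk_right x)
  have hAci : ∀ i, Continuous fun w => A x w t i := fun i =>
    (EuclideanSpace.proj i).continuous.comp hAc
  have hfc := hf.continuous_w x ht.le
  have hfw : Continuous fun w => fderiv ℝ (fun v => f v x t) w :=
    (hf.contDiff_w x t ht).continuous_fderiv one_ne_zero
  have hz := integral_sum_lineDeriv_eq_zero (G := fun i w => f w x t * A x w t i)
    (H := fun w => ‖fderiv ℝ (fun v => f v x t) w‖ * ‖A x w t‖ + L * |f w x t|)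
    (fun i => hfc.mul (hAci i)) (fun i => ?_) (fun i w => hf.differentiable_fA w x t ht i)
    (by fun_prop) (fun i w => ?_) ?_
  · rw [integral_congr_ae (Filter.Eventually.of_forall heq)] at hz
    have hs := integral_sub (i1.add i2') i3'
    simp only [Pi.add_apply] at hs
    rw [hs, integral_add i1 i2', integral_const_mul,
      integral_finsetSum _ fun i _ => i2 i, integral_finsetSum _ fun i _ => i3 i] at hz
    exact hz
  · refine hg.mono' (hfc.mul (hAci i)).aestronglyMeasurable
      (Filter.Eventually.of_forall fun w => ?_)
    rw [norm_mul]
    refine le_trans ?_ (h w x t le_rfl le_rfl le_rfl).1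
    exact mul_le_mul_of_nonneg_left (PiLp.norm_apply_le (A x w t) i) (abs_nonneg _)
  · have h1 := hf.abs_lineDeriv_mul_sub_le hL i w x ht
    have h2 : |fderiv ℝ (fun v => f v x t) w (unitVec i)| ≤ ‖fderiv ℝ (fun v => f v x t) w‖ := by
      simpa [norm_unitVec] using (fderiv ℝ (fun v => f v x t) w).le_opNorm (unitVec i)
    have h3 : |fderiv ℝ (fun v => f v x t) w (unitVec i) * A x w t i| ≤
        ‖fderiv ℝ (fun v => f v x t) w‖ * ‖A x w t‖ := by
      rw [abs_mul]
      exact mul_le_mul h2 (PiLp.norm_apply_le (A x w t) i) (abs_nonneg _) (norm_nonneg _)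
    have h4 := abs_sub_abs_le_abs_sub
      (lineDeriv ℝ (fun v : E3 => f v x t * A x v t i) w (unitVec i))
      (fderiv ℝ (fun v => f v x t) w (unitVec i) * A x w t i)
    linarith
  · exact ((i1.add i2').sub i3').congr (Filter.Eventually.of_forall fun w => (heq w).symm)

/-- The first coordinate is a dummy, so that the mass fits the format of the minimum principle. -/
theorem continuousOn_integral (hd : DecaysFast A B f) (hf : IsClassicalSolution ν A B f) :
    ContinuousOn (fun p : E3 × E3 × ℝ => ∫ w, f w p.2.1 p.2.2) {p | 0 ≤ p.2.2} := by
  rintro ⟨w₀, x₀, t₀⟩ h₀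
  obtain ⟨g, hg, h⟩ := hd.exists_bound (t₀ + 1) (‖x₀‖ + 1)
  have hnear : ∀ᶠ p : E3 × E3 × ℝ in nhdsWithin (w₀, x₀, t₀) {p | 0 ≤ p.2.2},
      0 ≤ p.2.2 ∧ p.2.2 ≤ t₀ + 1 ∧ ‖p.2.1‖ ≤ ‖x₀‖ + 1 := by
    have o1 : IsOpen {p : E3 × E3 × ℝ | p.2.2 < t₀ + 1} := isOpen_lt (by fun_prop) (by fun_prop)
    have o2 : IsOpen {p : E3 × E3 × ℝ | ‖p.2.1‖ < ‖x₀‖ + 1} :=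
      isOpen_lt (by fun_prop) (by fun_prop)
    filter_upwards [self_mem_nhdsWithin,
      mem_nhdsWithin_of_mem_nhds ((o1.inter o2).mem_nhds ⟨by simp, by simp⟩)] with p h1 h2
    exact ⟨h1, h2.1.le, h2.2.le⟩
  refine continuousWithinAt_of_dominated (bound := g) ?_ ?_ hg ?_
  · filter_upwards [hnear] with p hp using (hf.continuous_w p.2.1 hp.1).aestronglyMeasurable
  · filter_upwards [hnear] with p hp using
      Filter.Eventually.of_forall fun w => h w p.2.1 p.2.2 hp.1 hp.2.1 hp.2.2
  · refine Filter.Eventually.of_forall fun w => ?_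
    have : ContinuousOn (fun p : E3 × E3 × ℝ => f w p.2.1 p.2.2) {p | 0 ≤ p.2.2} :=
      hf.continuousOn.comp (f := fun p : E3 × E3 × ℝ => (w, p.2.1, p.2.2)) (by fun_prop)
        fun p hp => hp
    exact this _ h₀

/-- If the total mass satisfies a drift-diffusion equation, then it stays equal to one. -/
theorem integral_eq_one (hν : 0 ≤ ν) (hd : DecaysFast A B f) (hf : IsClassicalSolution ν A B f)
    {b : E3 → E3 → ℝ → E3}
    (hb : ∀ T, ∃ β, ∀ w x t, 0 ≤ t → t ≤ T →
      |∑ i, b x w t i * x i| ≤ β * (1 + ‖x‖ ^ 2 + ‖w‖ ^ 2))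
    (heq : ∀ w x t, 0 < t → (∫ v, deriv (fun s => f v x s) t)
      + (∑ i, b x w t i * ∫ v, fderiv ℝ (fun y => f v y t) x (unitVec i))
      - ν * ∑ i, ∫ v, iteratedFDeriv ℝ 2 (fun y => f v y t) x ![unitVec i, unitVec i] = 0)
    (h0 : ∀ x, ∫ w, f w x 0 = 1) (x : E3) {t : ℝ} (ht : 0 ≤ t) : ∫ w, f w x t = 1 := by
  -- With `σ = 1` and `σ = -1` the minimum principle bounds the mass from both sides; the equation
  -- is linear and has no zeroth-order term, hence `l = 0`.
  have key : ∀ σ : ℝ, 0 ≤ σ * ((∫ v, f v x t) - 1) := by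
    intro σ
    refine nonneg_of_supersolution (f := fun _ x t => σ * ((∫ v, f v x t) - 1))
      (ft := fun _ x t => σ * ∫ v, deriv (fun s => f v x s) t)
      (fx := fun i _ x t => σ * ∫ v, fderiv ℝ (fun y => f v y t) x (unitVec i))
      (fxx := fun i _ x t => σ * ∫ v, iteratedFDeriv ℝ 2 (fun y => f v y t) x
        ![unitVec i, unitVec i])
      (fw := fun _ _ _ _ => 0) (a := fun _ _ _ => 0) (b := b) (l := 0) hν le_rfl
      (((hd.continuousOn_integral hf).sub continuousOn_const).const_smul σ) (fun T => ?_)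
      (fun w x t ht => ((hd.hasDerivAt_integral_t hf x ht).2.sub_const 1).const_mul σ)
      (fun i w x t ht => ((hd.hasDerivAt_integral_x hf i x ht).2.sub_const 1).const_mul σ)
      (fun i w x t ht => (hd.hasDerivAt_integral_xx hf i x ht).2.const_mul σ)
      (fun i w x t ht => hasDerivAt_const _ _) (fun w x t ht _ => ?_) (fun T => ⟨0, ?_⟩) hb
      (fun w x => ?_) 0 x t ht
    · obtain ⟨k, g, hg, h⟩ := hd.decay T
      -- The `+ 1` absorbs the constant mass that is subtracted.
      refine ⟨|σ| * ((∫ v, |g v|) + 1), |k|, fun w x t h1 h2 => ?_⟩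
      have e1 : |∫ v, f v x t| ≤ Real.exp (|k| * (‖x‖ ^ 2 + ‖w‖ ^ 2)) * ∫ v, |g v| := by
        rw [← integral_const_mul, ← Real.norm_eq_abs]
        refine norm_integral_le_of_norm_le (hg.abs.const_mul _)
          (Filter.Eventually.of_forall fun v => ?_)
        exact (h v x t h1 h2).trans
          (exp_mul_le (sq_nonneg _) (le_add_of_nonneg_right (sq_nonneg _)))
      have e2 : 1 ≤ Real.exp (|k| * (‖x‖ ^ 2 + ‖w‖ ^ 2)) :=
        Real.one_le_exp (by positivity)
      rw [abs_mul, mul_assoc]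
      refine mul_le_mul_of_nonneg_left ?_ (abs_nonneg _)
      refine (abs_sub _ _).trans ?_
      rw [abs_one]
      linarith
    · have := heq w x t ht
      have e : ∑ i, b x w t i * (σ * ∫ v, fderiv ℝ (fun y => f v y t) x (unitVec i)) =
          σ * ∑ i, b x w t i * ∫ v, fderiv ℝ (fun y => f v y t) x (unitVec i) := by
        rw [Finset.mul_sum]; exact Finset.sum_congr rfl fun i _ => by ring
      rw [e, ← Finset.mul_sum]
      simp only [mul_zero, Finset.sum_const_zero, zero_mul, sub_zero]
      exact le_of_eq (by linear_combination -σ * this)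
    · simp
    · simp [h0 x]
  linarith [key 1, key (-1)]

end DecaysFast

/-! ### The three claims -/

theorem theorem4 (ν : ℝ) (hν : 0 ≤ ν) (A B : E3 → E3 → ℝ → E3)
    (hA : IsLipschitzField A) (hB : IsLipschitzField B)
    (f : E3 → E3 → ℝ → ℝ) (hf : IsClassicalSolution ν A B f) (hgrowth : HasGaussianGrowth f) :
    ((∀ w x : E3, 0 ≤ f w x 0) → ∀ (w x : E3) (t : ℝ), 0 ≤ t → 0 ≤ f w x t) ∧
    (DecaysFast A B f → (∀ x : E3, IsPDF (fun w => f w x 0)) →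
      ((∀ (x : E3) (t : ℝ), 0 < t → IsPDF (fun w => f w x t)) ↔ FluxDivergenceFree B f)) ∧
    (DecaysFast A B f → (∀ (x w w' : E3) (t : ℝ), 0 < t → B x w t = B x w' t) →
      (∀ (x w : E3) (t : ℝ), 0 < t → divX B x w t = 0) →
      (∀ x : E3, IsPDF (fun w => f w x 0)) →
      ∀ (x : E3) (t : ℝ), 0 < t → IsPDF (fun w => f w x t)) := by
  have hnonneg := hf.nonneg hν hA hB hgrowth
  have hbx : ∀ T, ∃ β, ∀ w x t, 0 ≤ t → t ≤ T →
      |∑ i, B x w t i * x i| ≤ β * (1 + ‖x‖ ^ 2 + ‖w‖ ^ 2) := fun T => by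
    obtain ⟨β, hβ⟩ := hB.exists_abs_sum_mul_le T
    exact ⟨β, fun w x t h1 h2 => (hβ x w t h1 h2).1⟩
  refine ⟨hnonneg, fun hd h0 => ⟨fun hpdf x t ht => ?_, fun hflux x t ht => ?_⟩,
    fun hd hBw hdiv h0 x t ht => ?_⟩
  · have hfl := fun i => (hd.hasDerivAt_integral_flux hf hB i x ht).2
    refine ⟨fun i => HasLineDerivAt.lineDifferentiableAt (hfl i), ?_⟩
    have e1 : ∫ w, deriv (fun s => f w x s) t = 0 := by
      refine (hd.hasDerivAt_integral_t hf x ht).2.unique ?_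
      refine (hasDerivAt_const t (1 : ℝ)).congr_of_eventuallyEq ?_
      filter_upwards [lt_mem_nhds ht] with s hs using (hpdf x s hs).2.2
    -- Needed at every `y`, not only at `x`, because the second derivatives arise by differentiating
    -- this identity.
    have e2 : ∀ i y, ∫ w, fderiv ℝ (fun y => f w y t) y (unitVec i) = 0 := fun i y => by
      refine (hd.hasDerivAt_integral_x hf i y ht).2.unique ?_
      refine (hasDerivAt_const (0 : ℝ) (1 : ℝ)).congr_of_eventuallyEq ?_
      exact Filter.Eventually.of_forall fun s => (hpdf _ t ht).2.2
    have e3 : ∀ i, ∫ w, iteratedFDeriv ℝ 2 (fun y => f w y t) x ![unitVec i, unitVec i] = 0 :=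
      fun i => by
        refine (hd.hasDerivAt_integral_xx hf i x ht).2.unique ?_
        refine (hasDerivAt_const (0 : ℝ) (0 : ℝ)).congr_of_eventuallyEq ?_
        exact Filter.Eventually.of_forall fun s => e2 i _
    have := hd.integrated_equation hf hA hB x ht
    simp only [e1, e3, Finset.sum_const_zero, mul_zero, sub_zero, zero_add] at this
    rw [← this]
    exact Finset.sum_congr rfl fun i _ =>
      (show HasLineDerivAt ℝ (fun y => ∫ w, B y w t i * f w y t) _ x (unitVec i) from hfl i).lineDeriv
  · refine ⟨fun w => hnonneg (fun w x => (h0 x).1 w) w x t ht.le, hd.integrable hf x ht.le, ?_⟩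
    -- The flux condition removes the whole transport term, so the mass solves a pure heat equation
    -- with zero drift.
    refine hd.integral_eq_one hν hf (b := fun _ _ _ => 0) (fun T => ⟨0, by simp⟩)
      (fun _ x t ht => ?_) (fun x => (h0 x).2.2) x ht.le
    have h1 := hd.integrated_equation hf hA hB x ht
    have h2 := (hflux x t ht).2
    have h3 : ∀ i, lineDeriv ℝ (fun y : E3 => ∫ w, B y w t i * f w y t) x (unitVec i) =
        ∫ w, (lineDeriv ℝ (fun y => B y w t i) x (unitVec i) * f w x t
          + B x w t i * fderiv ℝ (fun y => f w y t) x (unitVec i)) := fun i =>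
      HasLineDerivAt.lineDeriv (hd.hasDerivAt_integral_flux hf hB i x ht).2
    simp only [h3] at h2
    rw [h2] at h1
    simpa using h1
  · refine ⟨fun w => hnonneg (fun w x => (h0 x).1 w) w x t ht.le, hd.integrable hf x ht.le, ?_⟩
    refine hd.integral_eq_one hν hf hbx (fun w x t ht => ?_) (fun x => (h0 x).2.2) x ht.le
    have h1 := hd.integrated_equation hf hA hB x ht
    -- `B` and its derivatives do not depend on `v` and leave the integral; the derivatives add up
    -- to the divergence, which vanishes, and `B · ∇F` remains.
    have h3 : ∑ i, ∫ v, (lineDeriv ℝ (fun y => B y v t i) x (unitVec i) * f v x t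
          + B x v t i * fderiv ℝ (fun y => f v y t) x (unitVec i)) =
        ∑ i, B x w t i * ∫ v, fderiv ℝ (fun y => f v y t) x (unitVec i) := by
      have hl : ∀ i v, lineDeriv ℝ (fun y => B y v t i) x (unitVec i) =
          lineDeriv ℝ (fun y => B y w t i) x (unitVec i) := fun i v => by
        simp only [fun y => hBw y v w t ht]
      simp only [hl, fun v => hBw x v w t ht]
      have hs : ∑ i, lineDeriv ℝ (fun y => B y w t i) x (unitVec i) = 0 := hdiv x w t ht
      have hi : ∀ i, ∫ v, (lineDeriv ℝ (fun y => B y w t i) x (unitVec i) * f v x t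
          + B x w t i * fderiv ℝ (fun y => f v y t) x (unitVec i)) =
          lineDeriv ℝ (fun y => B y w t i) x (unitVec i) * (∫ v, f v x t) +
          B x w t i * ∫ v, fderiv ℝ (fun y => f v y t) x (unitVec i) := fun i => by
        rw [integral_add ((hd.integrable hf x ht.le).const_mul _)
          ((hd.hasDerivAt_integral_x hf i x ht).1.const_mul _), integral_const_mul,
          integral_const_mul]
      simp only [hi]
      rw [Finset.sum_add_distrib, ← Finset.sum_mul, hs, zero_mul, zero_add]
    rw [h3] at h1
    exact h1
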